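/- **Setting.** Let $L>0$, $\Omega=[0,L]^2$, and let $\mathcal V$ be the set of $\mathbb R^2$-valued $\Omega$-periodic divergence-free trigonometric polynomials with zero average over $\Omega$. Let $H$ be the closure of $\mathcal V$ in $L^2(\Omega)^2$ and $V$ the closure of $\mathcal V$ in $H^1(\Omega)^2$, where $V$ is normed by $\|u\|=\big(\int_\Omega\sum_{j=1}^2|\partial_j u|^2\,dx\big)^{1/2}$. Identify $V\subset H=H'\subset V'$ and define $A:V\to V'$, $B:V\times V\to V'$ by $$\langle Au,w\rangle=\int_\Omega\sum_{j=1}^2\partial_j u\cdot\partial_j w\,dx,\qquad \langle B(u,v),w\rangle=\int_\Omega((u\cdot\nabla)v)\cdot w\,dx,$$ and set $B_{\rm s}(u,v)=B(u,v)+B(v,u)$. Let $g\in H\setminus\{0\}$, let $\alpha_n>0$ with $\alpha_n\to\infty$, and let $v_n\in V$ $(n\in\mathbb N)$ be weak steady states: $$Av_n+\alpha_nB(v_n,v_n)=g\quad\text{in }V'\text{ for all }n .$$ **Expansions.** Let $v\in V$, let $\mathcal N$ be $\emptyset$, $\{1,\dots,K\}$ for some integer $K\ge1$, or $\{1,2,3,\dots\}$,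 and for $k\in\mathcal N$ let $w_k\in V$ and $\Gamma_{k,n}>0$ $(n\in\mathbb N)$. We write $v_n\approx v+\sum_{k\in\mathcal N}\Gamma_{k,n}w_k$ in $V$ (a *relaxed expansion*) if the following holds. If $\mathcal N=\emptyset$ (the *trivial* expansion), then $v_n=v$ for all $n$. If $\mathcal N\neq\emptyset$, then $\lim_{n\to\infty}\Gamma_{1,n}=0$; $\lim_{n\to\infty}\Gamma_{k+1,n}/\Gamma_{k,n}=0$ whenever $k,k+1\in\mathcal N$; and there are $w^{(k)}_n\in V$ with $\|w_n^{(k)}-w_k\|\to0$ as $n\to\infty$ for each $k\in\mathcal N$ and $$v_n=v+\sum_{j=1}^{k-1}\Gamma_{j,n}w_j+\Gamma_{k,n}w_n^{(k)}\quad\text{for all }k\in\mathcal N,\ n\in\mathbb N;$$ if moreover $\mathcal N=\{1,\dots,K\}$, then $w^{(K)}_n=w_K\ne0$ for all $n$. The expansion is *unitary* if $\|w_k\|=1$ for all $k\in\mathcal N$. It is *degenerate* if $\mathcal N=\{1,2,3,\dots\}$ and either $w_k=0$ for all $k$, or there is $N\ge1$ with $\|w_k\|=1$ for $k\le N$ and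 $w_k=0$ for $k>N$. For sequences of positive numbers, $\xi_n\succ\eta_n$ means $\xi_n/\eta_n\to\infty$, $\xi_n\sim\eta_n$ means that $\xi_n/\eta_n$ converges to a limit in $(0,\infty)$, and $\xi_n\succsim\eta_n$ means $\xi_n\succ\eta_n$ or $\xi_n\sim\eta_n$. **Theorem.** Suppose that $v_n\approx v+\sum_{k\in\mathcal N}\Gamma_{k,n}w_k$ in $V$ is a unitary expansion or a degenerate expansion. Then the following hold, all equations being in $V'$. (i) $B(v,v)=0$. (ii) If the expansion is trivial, then $Av=g$. (iii) If the expansion is not trivial, then: (a) if $1\succsim\alpha_n\Gamma_{1,n}$, then the limit $\mu=\lim_{n\to\infty}\alpha_n\Gamma_{1,n}\in[0,\infty)$ exists and $Av+\mu B_{\rm s}(v,w_1)=g$; (b) if $\alpha_n\Gamma_{1,n}\succ1$, then $B_{\rm s}(v,w_1)=0$. -/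

import Mathlib

open MeasureTheory Filter Topology

noncomputable section

namespace SteadyNSE

/-! ### The periodic box and trigonometric polynomials -/

/-- The Euclidean plane. -/
abbrev Plane : Type := EuclideanSpace ℝ (Fin 2)

/-- The periodic box `Ω = [0, L]²`. -/
def box (L : ℝ) : Set Plane := {x | ∀ i, x i ∈ Set.Icc (0 : ℝ) L}

/-- Lebesgue measure on `Ω`. -/
abbrev boxMeasure (L : ℝ) : Measure Plane := volume.restrict (box L)

/-- The phase `(2π / L) k · x` for a wave vector `k ∈ ℤ²`. -/
def phase (L : ℝ) (k : Fin 2 → ℤ) (x : Plane) : ℝ :=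
  2 * Real.pi / L * ∑ i, (k i : ℝ) * x i

/-- The `ℝ²`-valued `Ω`-periodic trigonometric polynomials: finite real linear combinations of
`x ↦ cos((2π / L) k · x) a` and `x ↦ sin((2π / L) k · x) a`, with `k ∈ ℤ²` and `a ∈ ℝ²`. -/
def trigPoly (L : ℝ) : Submodule ℝ (Plane → Plane) :=
  Submodule.span ℝ {p | ∃ (k : Fin 2 → ℤ) (a : Plane),
    p = (fun x => Real.cos (phase L k x) • a) ∨ p = (fun x => Real.sin (phase L k x) • a)}

/-- The (classical) partial derivative `∂p / ∂x_j` of a vector field. -/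
def partialDeriv (j : Fin 2) (p : Plane → Plane) (x : Plane) : Plane :=
  fderiv ℝ p x (EuclideanSpace.single j 1)

/-- The divergence of a vector field. -/
def divergence (p : Plane → Plane) (x : Plane) : ℝ := ∑ j, partialDeriv j p x j

lemma isCompact_box (L : ℝ) : IsCompact (box L) := by
  have h : box L = (EuclideanSpace.equiv (Fin 2) ℝ).toHomeomorph ⁻¹'
      (Set.univ.pi fun _ => Set.Icc (0 : ℝ) L) := by
    ext x
    simp only [box, Set.mem_ofPred_eq, Set.mem_preimage, Set.mem_univ_pi]
    rfl
  rw [h]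
  exact (Homeomorph.isCompact_preimage _).2 (isCompact_univ_pi fun _ => isCompact_Icc)

instance isFiniteMeasure_boxMeasure (L : ℝ) : IsFiniteMeasure (boxMeasure L) :=
  ⟨by rw [Measure.restrict_apply_univ]; exact (isCompact_box L).measure_lt_top⟩

lemma contDiff_of_mem_trigPoly {L : ℝ} {p : Plane → Plane} (hp : p ∈ trigPoly L) :
    ContDiff ℝ 1 p := by
  induction hp using Submodule.span_induction with
  | mem p hp =>
    obtain ⟨k, a, rfl | rfl⟩ := hp
    · unfold phase
      fun_prop
    · unfold phase
      fun_prop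
  | zero => exact contDiff_const
  | add p q _ _ hp hq => exact hp.add hq
  | smul c p _ hp => exact hp.const_smul c

lemma continuous_partialDeriv {L : ℝ} {p : Plane → Plane} (hp : p ∈ trigPoly L) (j : Fin 2) :
    Continuous (partialDeriv j p) :=
  ((contDiff_of_mem_trigPoly hp).continuous_fderiv (by norm_num)).clm_apply continuous_const

lemma memLp_of_continuous (L : ℝ) {p : Plane → Plane} (hp : Continuous p) :
    MemLp p 2 (boxMeasure L) := by
  obtain ⟨C, hC⟩ := (isCompact_box L).exists_bound_of_continuousOn hp.continuousOn
  exact MemLp.of_bound hp.aestronglyMeasurable C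
    (ae_restrict_of_forall_mem (isCompact_box L).measurableSet hC)

lemma partialDeriv_add {L : ℝ} {p q : Plane → Plane} (hp : p ∈ trigPoly L) (hq : q ∈ trigPoly L)
    (j : Fin 2) : partialDeriv j (p + q) = partialDeriv j p + partialDeriv j q := by
  funext x
  have h1 := (contDiff_of_mem_trigPoly hp).differentiable (by norm_num) x
  have h2 := (contDiff_of_mem_trigPoly hq).differentiable (by norm_num) x
  simp [partialDeriv, fderiv_add h1 h2]

lemma partialDeriv_smul {L : ℝ} {p : Plane → Plane} (hp : p ∈ trigPoly L) (c : ℝ)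
    (j : Fin 2) : partialDeriv j (c • p) = c • partialDeriv j p := by
  funext x
  have h1 := (contDiff_of_mem_trigPoly hp).differentiable (by norm_num) x
  simp [partialDeriv, fderiv_const_smul h1 c]

/-- The set `𝒱` of `ℝ²`-valued `Ω`-periodic divergence-free trigonometric polynomials with zero
average over `Ω`. -/
def solenoidal (L : ℝ) : Submodule ℝ (Plane → Plane) where
  carrier := {p | p ∈ trigPoly L ∧ (∀ x, divergence p x = 0) ∧ ∫ x, p x ∂(boxMeasure L) = 0}
  zero_mem' := by
    refine ⟨Submodule.zero_mem _, fun x => ?_, by simp⟩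
    simp [divergence, partialDeriv]
  add_mem' := by
    rintro p q ⟨hp, hp', hp''⟩ ⟨hq, hq', hq''⟩
    refine ⟨Submodule.add_mem _ hp hq, fun x => ?_, ?_⟩
    · have h1 := hp' x
      have h2 := hq' x
      simp only [divergence, partialDeriv_add hp hq, Pi.add_apply, PiLp.add_apply,
        Finset.sum_add_distrib] at *
      rw [h1, h2, add_zero]
    · have h1 := (memLp_of_continuous L (contDiff_of_mem_trigPoly hp).continuous).integrable
        (by norm_num)
      have h2 := (memLp_of_continuous L (contDiff_of_mem_trigPoly hq).continuous).integrable
        (by norm_num)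
      simp only [Pi.add_apply]
      rw [integral_add h1 h2, hp'', hq'', add_zero]
  smul_mem' := by
    rintro c p ⟨hp, hp', hp''⟩
    refine ⟨Submodule.smul_mem _ c hp, fun x => ?_, ?_⟩
    · have h1 := hp' x
      simp only [divergence, partialDeriv_smul hp, Pi.smul_apply, PiLp.smul_apply,
        smul_eq_mul, ← Finset.mul_sum] at *
      rw [h1, mul_zero]
    · simp only [Pi.smul_apply]
      rw [integral_smul, hp'', smul_zero]

/-! ### The spaces `H` and `V` -/

/-- `L²(Ω)²`. -/
abbrev L2 (L : ℝ) : Type := Lp Plane 2 (boxMeasure L)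

/-- Pairs `(∂₁u, ∂₂u)` of square-integrable vector fields, with the Hilbert norm
`(∫_Ω |∂₁u|² + |∂₂u|²)^{1/2}`. -/
abbrev GradL2 (L : ℝ) : Type := PiLp 2 fun _ : Fin 2 => L2 L

/-- The class in `L²(Ω)²` of an element of `𝒱`. -/
def toL2 (L : ℝ) : solenoidal L →ₗ[ℝ] L2 L where
  toFun p := (memLp_of_continuous L (contDiff_of_mem_trigPoly p.2.1).continuous).toLp p.1
  map_add' _ _ := rfl
  map_smul' _ _ := rfl

/-- The class in `L²(Ω)²` of the partial derivative `∂p / ∂x_j` of `p ∈ 𝒱`. -/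
def derivToL2 (L : ℝ) (j : Fin 2) : solenoidal L →ₗ[ℝ] L2 L where
  toFun p := (memLp_of_continuous L (continuous_partialDeriv p.2.1 j)).toLp (partialDeriv j p.1)
  map_add' p q := by
    rw [← MemLp.toLp_add]
    exact MemLp.toLp_congr _ _ (by rw [← partialDeriv_add p.2.1 q.2.1]; rfl)
  map_smul' c p := by
    rw [RingHom.id_apply, ← MemLp.toLp_const_smul]
    exact MemLp.toLp_congr _ _ (by rw [← partialDeriv_smul p.2.1]; rfl)

/-- The map `p ↦ (p, (∂₁p, ∂₂p))` on `𝒱`. Elements of `H¹(Ω)²` are identified with the pairs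
`(u, (∂₁u, ∂₂u))`; this identifies the topology of `H¹(Ω)²` with that of
`L²(Ω)² × (L²(Ω)²)²`. -/
def toGraph (L : ℝ) : solenoidal L →ₗ[ℝ] L2 L × GradL2 L :=
  (toL2 L).prod
    ((WithLp.linearEquiv 2 ℝ (Fin 2 → L2 L)).symm.toLinearMap ∘ₗ LinearMap.pi (derivToL2 L))

/-- The space `H`: the closure of `𝒱` in `L²(Ω)²`. -/
def spaceH (L : ℝ) : Submodule ℝ (L2 L) := (LinearMap.range (toL2 L)).topologicalClosure

/-- The closure of `𝒱` in `H¹(Ω)²`. -/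
def closureH1 (L : ℝ) : Submodule ℝ (L2 L × GradL2 L) :=
  (LinearMap.range (toGraph L)).topologicalClosure

/-- The space `V`: the closure of `𝒱` in `H¹(Ω)²`, to be normed by `‖u‖ = |∇u|` below. It is a
separate type so that it does not inherit the norm of the product. -/
def SpaceV (L : ℝ) : Type := closureH1 L

instance (L : ℝ) : AddCommGroup (SpaceV L) := inferInstanceAs (AddCommGroup (closureH1 L))

instance (L : ℝ) : Module ℝ (SpaceV L) := inferInstanceAs (Module ℝ (closureH1 L))

/-- The underlying function `u ∈ L²(Ω)²` of an element of `V`. -/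
def SpaceV.fn {L : ℝ} : SpaceV L →ₗ[ℝ] L2 L :=
  LinearMap.fst ℝ (L2 L) (GradL2 L) ∘ₗ (closureH1 L).subtype

/-- The weak gradient `(∂₁u, ∂₂u)` of an element of `V`. -/
def SpaceV.grad {L : ℝ} : SpaceV L →ₗ[ℝ] GradL2 L :=
  LinearMap.snd ℝ (L2 L) (GradL2 L) ∘ₗ (closureH1 L).subtype

/-- The norm `‖u‖ = (∫_Ω ∑ⱼ |∂u/∂x_j|²)^{1/2}` of `V`. (By the Poincaré inequality it is indeed a
norm, and it is equivalent to the norm of `H¹(Ω)²`.) -/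
instance (L : ℝ) : SeminormedAddCommGroup (SpaceV L) :=
  SeminormedAddCommGroup.induced (SpaceV L) (GradL2 L) SpaceV.grad

instance (L : ℝ) : NormedSpace ℝ (SpaceV L) :=
  NormedSpace.induced ℝ (SpaceV L) (GradL2 L) SpaceV.grad

/-! ### The operators `A` and `B`

Elements of the dual space `V'` are given by their values `⟨·, w⟩_{V',V}` at all `w ∈ V`; equality
in `V'` is equality of these functions of `w`. -/

/-- The functional `Au ∈ V'`: `⟨Au, w⟩ = ∫_Ω ∑ⱼ ∂ⱼu · ∂ⱼw dx`. -/
def opA {L : ℝ} (u : SpaceV L) : SpaceV L → ℝ := fun w =>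
  ∫ x, ∑ j, inner ℝ (u.grad j x) (w.grad j x) ∂(boxMeasure L)

/-- The functional `B(u, v) ∈ V'`:
`⟨B(u, v), w⟩ = ∫_Ω ((u · ∇) v) · w dx`, where `(u · ∇) v = ∑ⱼ uⱼ ∂ⱼv`. -/
def opB {L : ℝ} (u v : SpaceV L) : SpaceV L → ℝ := fun w =>
  ∫ x, inner ℝ (∑ j, (u.fn x j) • v.grad j x) (w.fn x) ∂(boxMeasure L)

/-- `B_s(u, v) = B(u, v) + B(v, u)`. -/
def opBs {L : ℝ} (u v : SpaceV L) : SpaceV L → ℝ := opB u v + opB v u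

/-- The identification `H = H' ⊂ V'`: `⟨g, w⟩ = ∫_Ω g · w dx`. -/
def functionalOfH {L : ℝ} (g : spaceH L) : SpaceV L → ℝ := fun w =>
  ∫ x, inner ℝ (g.1 x) (w.fn x) ∂(boxMeasure L)

/-! ### Asymptotic expansions in a normed space -/

section Expansion

variable {Z : Type*} [SeminormedAddCommGroup Z] [NormedSpace ℝ Z]

/-- The index set `𝒩 = {k ∈ ℕ : 1 ≤ k ≤ K}` of an expansion of length `K ∈ {0, 1, 2, …, ∞}`; it is
empty for `K = 0`, `{1, …, K}` for finite `K`, and `{1, 2, 3, …}` for `K = ∞`. -/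
def indexSet (K : ℕ∞) : Set ℕ := {k | 1 ≤ k ∧ (k : ℕ∞) ≤ K}

/-- `z_n ≈ v + ∑_{k ∈ 𝒩} Γ_{k,n} w_k` is a relaxed expansion of length `K` in `Z`. The length is
`0` for the trivial expansion, finite and positive for a nontrivial finite expansion, and `∞` for an
infinite expansion. Only the values of `Γ k` and `w k` for `k ∈ 𝒩` matter. -/
structure IsRelaxedExpansion (z : ℕ → Z) (v : Z) (K : ℕ∞) (Γ : ℕ → ℕ → ℝ) (w : ℕ → Z) :
    Prop where
  /-- In the trivial case the sequence is constant. -/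
  trivial : K = 0 → ∀ n, z n = v
  pos : ∀ k ∈ indexSet K, ∀ n, 0 < Γ k n
  first : 1 ∈ indexSet K → Tendsto (Γ 1) atTop (𝓝 0)
  ratio : ∀ k ∈ indexSet K, k + 1 ∈ indexSet K →
    Tendsto (fun n => Γ (k + 1) n / Γ k n) atTop (𝓝 0)
  /-- The remainders `r k n = w_n^{(k)}`. -/
  remainder : ∃ r : ℕ → ℕ → Z,
    (∀ k ∈ indexSet K, Tendsto (fun n => ‖r k n - w k‖) atTop (𝓝 0)) ∧
    (∀ k ∈ indexSet K, ∀ n,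
      z n = v + ∑ j ∈ Finset.Ico 1 k, Γ j n • w j + Γ k n • r k n) ∧
    (∀ k ∈ indexSet K, (k : ℕ∞) = K → ∀ n, r k n = w k)
  /-- In the nontrivial finite case the last term is nonzero. -/
  last_ne_zero : ∀ k ∈ indexSet K, (k : ℕ∞) = K → w k ≠ 0

/-- Unitary expansion: a relaxed expansion all of whose `w_k` are unit vectors. -/
def IsUnitaryExpansion (z : ℕ → Z) (v : Z) (K : ℕ∞) (Γ : ℕ → ℕ → ℝ) (w : ℕ → Z) : Prop :=
  IsRelaxedExpansion z v K Γ w ∧ ∀ k ∈ indexSet K, ‖w k‖ = 1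

/-- Degenerate expansion: an infinite expansion for which either all `w_k` vanish, or there is
`N ≥ 1` such that `w_1, …, w_N` are unit vectors and all later `w_k` vanish. -/
def IsDegenerateExpansion (z : ℕ → Z) (v : Z) (K : ℕ∞) (Γ : ℕ → ℕ → ℝ) (w : ℕ → Z) : Prop :=
  K = ⊤ ∧ IsRelaxedExpansion z v K Γ w ∧
    ((∀ k, 1 ≤ k → w k = 0) ∨
      ∃ N : ℕ, 1 ≤ N ∧ (∀ k, 1 ≤ k → k ≤ N → ‖w k‖ = 1) ∧ ∀ k, N < k → w k = 0)

end Expansion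

/-! ### Comparison of positive sequences -/

/-- `ξ ≻ η`: `ξ_n / η_n → ∞`. -/
def SeqSucc (ξ η : ℕ → ℝ) : Prop := Tendsto (fun n => ξ n / η n) atTop atTop

/-- `ξ ∼ η`: `ξ_n / η_n → λ` for some `λ ∈ (0, ∞)`. -/
def SeqSim (ξ η : ℕ → ℝ) : Prop := ∃ l : ℝ, 0 < l ∧ Tendsto (fun n => ξ n / η n) atTop (𝓝 l)

/-- `ξ ≿ η`: `ξ ≻ η` or `ξ ∼ η`. -/
def SeqSuccsim (ξ η : ℕ → ℝ) : Prop := SeqSucc ξ η ∨ SeqSim ξ η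

end SteadyNSE

end

/-! Dividing the equation by `α n` gives `B(zₙ, zₙ) = (g - A zₙ)/αₙ → 0`, hence `B(v, v) = 0`.
Substituting `zₙ = v + Γ₁ₙ rₙ` with `rₙ → w₁` then leaves `A zₙ + αₙ Γ₁ₙ Qₙ = g`, where `Qₙ = B_s(v,
rₙ) + Γ₁ₙ B(rₙ, rₙ) → B_s(v, w₁)`. The behaviour of `αₙ Γ₁ₙ` decides which terms survive. Only the
first order of the expansion enters, and every limit is taken in `ℝ` after testing against a fixed
element of `V`.

The analytic content is the continuity of `B` for the gradient norm (`exists_norm_opB_le`,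
`tendsto_opB`). By Hölder it reduces to `V ⊂ L⁴` (`exists_eLpNorm_fn_le`), a density consequence of
Ladyzhenskaya's inequality (`exists_eLpNorm_four_le`). That in turn comes from the planar estimate
`‖k‖₂ ≤ ‖∂₁k‖₁ + ‖∂₂k‖₁` for zero-average `k`, applied twice: to `p`, giving Poincaré, and to `|p|²`
minus its average. -/

noncomputable section

namespace SteadyNSE

/-! ### Gagliardo's `W^{1,1} ⊂ L²` estimate on a square -/

section Square

variable {E : Type*} [NormedAddCommGroup E] [NormedSpace ℝ E] [CompleteSpace E]

/-- Fundamental theorem of calculus, with a bound independent of both endpoints so that it can be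
integrated over them. -/
lemma enorm_sub_le_lintegral_deriv {L : ℝ} {f f' : ℝ → E} (hf : ∀ t, HasDerivAt f (f' t) t)
    (hf' : Continuous f') {s t : ℝ} (hs : s ∈ Set.Icc 0 L) (ht : t ∈ Set.Icc 0 L) :
    ‖f t - f s‖ₑ ≤ ∫⁻ r in Set.Icc 0 L, ‖f' r‖ₑ := by
  rw [← intervalIntegral.integral_eq_sub_of_hasDerivAt (fun r _ => hf r)
    (hf'.intervalIntegrable s t), ← ofReal_norm, intervalIntegral.norm_intervalIntegral_eq,
    ofReal_norm]
  refine (enorm_integral_le_lintegral_enorm _).trans (lintegral_mono_set ?_)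
  exact Set.uIoc_subset_uIcc.trans (Set.uIcc_subset_Icc hs ht)

/-- Averaging `k x - k y` over `y` recovers `k x` when the mean vanishes; pointwise size is thus
controlled by differences. -/
lemma enorm_le_of_integral_eq_zero {X : Type*} [MeasurableSpace X] {μ : Measure X}
    [IsFiniteMeasure μ] {k : X → E} (hk : Integrable k μ) (h0 : ∫ y, k y ∂μ = 0) (x : X) :
    μ Set.univ * ‖k x‖ₑ ≤ ∫⁻ y, ‖k x - k y‖ₑ ∂μ := by
  have h : ∫ y, (k x - k y) ∂μ = μ.real Set.univ • k x := by
    rw [integral_sub (integrable_const _) hk, h0, sub_zero, integral_const]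
  have h2 := enorm_integral_le_lintegral_enorm (μ := μ) (fun y => k x - k y)
  rw [h, enorm_smul] at h2
  refine le_of_eq_of_le ?_ h2
  rw [Measure.real, Real.enorm_eq_ofReal ENNReal.toReal_nonneg,
    ENNReal.ofReal_toReal (measure_ne_top _ _)]

/-- Gagliardo's trick: bound one factor of `G * G` by a function of each variable alone, so that
Tonelli splits the integral. -/
lemma lintegral_sq_le_of_le_of_le {μ ν : Measure ℝ} [SFinite μ] [SFinite ν] {G : ℝ × ℝ → ENNReal}
    {a b : ℝ → ENNReal} (ha : AEMeasurable a ν) (hb : AEMeasurable b μ)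
    (hGa : ∀ᵐ x ∂(μ.prod ν), G x ≤ a x.2) (hGb : ∀ᵐ x ∂(μ.prod ν), G x ≤ b x.1) :
    ∫⁻ x, G x ^ 2 ∂(μ.prod ν) ≤ (∫⁻ s, b s ∂μ) * ∫⁻ t, a t ∂ν := by
  rw [← lintegral_prod_mul hb ha]
  refine lintegral_mono_ae ?_
  filter_upwards [hGa, hGb] with x h1 h2
  rw [sq]
  exact mul_le_mul' h2 h1

/-- Joining `x` to `y` through either corner of their rectangle, and averaging over `y`, bounds `k
x` by a function of `x.2` alone or of `x.1` alone. Both bounds have the same integral up to the side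
length, whose powers cancel at the end. -/
theorem lintegral_sq_le_of_integral_eq_zero {L : ℝ} (hL : 0 < L) {k d₁ d₂ : ℝ × ℝ → E}
    (hk : Continuous k) (hd₁ : Continuous d₁) (hd₂ : Continuous d₂)
    (h₁ : ∀ s t, HasDerivAt (fun s => k (s, t)) (d₁ (s, t)) s)
    (h₂ : ∀ s t, HasDerivAt (fun t => k (s, t)) (d₂ (s, t)) t)
    (h0 : ∫ x, k x ∂((volume.restrict (Set.Icc 0 L)).prod (volume.restrict (Set.Icc 0 L))) = 0) :
    ∫⁻ x, ‖k x‖ₑ ^ 2 ∂((volume.restrict (Set.Icc 0 L)).prod (volume.restrict (Set.Icc 0 L))) ≤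
      (∫⁻ x, ‖d₁ x‖ₑ ∂((volume.restrict (Set.Icc 0 L)).prod (volume.restrict (Set.Icc 0 L))) +
       ∫⁻ x, ‖d₂ x‖ₑ ∂((volume.restrict (Set.Icc 0 L)).prod (volume.restrict (Set.Icc 0 L))))
        ^ 2 := by
  set ν : Measure ℝ := volume.restrict (Set.Icc 0 L) with hν
  set D₁ := ∫⁻ x, ‖d₁ x‖ₑ ∂(ν.prod ν) with hD₁
  set D₂ := ∫⁻ x, ‖d₂ x‖ₑ ∂(ν.prod ν) with hD₂
  have hl : ν Set.univ = ENNReal.ofReal L := by simp [hν]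
  have hl0 : ENNReal.ofReal L ≠ 0 := by simpa using hL
  have hlt : ENNReal.ofReal L ≠ ⊤ := ENNReal.ofReal_ne_top
  set l := ENNReal.ofReal L
  have huniv : (ν.prod ν) Set.univ = l * l := by
    rw [← Set.univ_prod_univ, Measure.prod_prod, hl]
  have hmem : ∀ᵐ x ∂(ν.prod ν), x.1 ∈ Set.Icc 0 L ∧ x.2 ∈ Set.Icc 0 L := by
    rw [hν, Measure.prod_restrict]
    exact ae_restrict_mem (measurableSet_Icc.prod measurableSet_Icc)
  have hint : Integrable k (ν.prod ν) := by
    rw [hν, Measure.prod_restrict]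
    exact hk.continuousOn.integrableOn_compact (isCompact_Icc.prod isCompact_Icc)
  set F₁ : ℝ → ENNReal := fun t => ∫⁻ s, ‖d₁ (s, t)‖ₑ ∂ν with hF₁
  set F₂ : ℝ → ENNReal := fun s => ∫⁻ t, ‖d₂ (s, t)‖ₑ ∂ν with hF₂
  have hm₁ : Measurable F₁ := hd₁.enorm.measurable.lintegral_prod_left'
  have hm₂ : Measurable F₂ := hd₂.enorm.measurable.lintegral_prod_right'
  have hI₁ : ∫⁻ t, F₁ t ∂ν = D₁ := (lintegral_prod_symm _ hd₁.enorm.measurable.aemeasurable).symm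
  have hI₂ : ∫⁻ s, F₂ s ∂ν = D₂ := (lintegral_prod _ hd₂.enorm.measurable.aemeasurable).symm
  have e₁ : ∀ s ∈ Set.Icc 0 L, ∀ s' ∈ Set.Icc 0 L, ∀ t, ‖k (s, t) - k (s', t)‖ₑ ≤ F₁ t :=
    fun s hs s' hs' t => enorm_sub_le_lintegral_deriv (fun s => h₁ s t)
      (hd₁.comp (by fun_prop)) hs' hs
  have e₂ : ∀ s, ∀ t ∈ Set.Icc 0 L, ∀ t' ∈ Set.Icc 0 L, ‖k (s, t) - k (s, t')‖ₑ ≤ F₂ s :=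
    fun s t ht t' ht' => enorm_sub_le_lintegral_deriv (fun t => h₂ s t)
      (hd₂.comp (by fun_prop)) ht' ht
  -- Path through the corner `(y.1, x.2)`: integrating `F₂ y.1` over `y` removes the dependence on
  -- `x.1`.
  have hGa : ∀ᵐ x ∂(ν.prod ν), l * ‖k x‖ₑ ≤ l * F₁ x.2 + D₂ := by
    filter_upwards [hmem] with x hx
    have h := enorm_le_of_integral_eq_zero hint h0 x
    have h' : ∫⁻ y, ‖k x - k y‖ₑ ∂(ν.prod ν) ≤ ∫⁻ y, (F₁ x.2 + F₂ y.1) ∂(ν.prod ν) := by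
      refine lintegral_mono_ae ?_
      filter_upwards [hmem] with y hy
      have : k x - k y = (k (x.1, x.2) - k (y.1, x.2)) + (k (y.1, x.2) - k (y.1, y.2)) := by simp
      rw [this]
      exact (enorm_add_le _ _).trans (add_le_add (e₁ _ hx.1 _ hy.1 _) (e₂ _ _ hx.2 _ hy.2))
    have h'' : ∫⁻ y, (F₁ x.2 + F₂ y.1) ∂(ν.prod ν) = l * (l * F₁ x.2 + D₂) := by
      rw [lintegral_add_left measurable_const, lintegral_const, huniv,
        lintegral_prod (fun y : ℝ × ℝ => F₂ y.1) (by fun_prop)]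
      simp only [lintegral_const, hl]
      rw [lintegral_mul_const _ hm₂, hI₂]
      ring
    have := (h.trans h').trans_eq h''
    rwa [huniv, mul_assoc, ENNReal.mul_le_mul_iff_right hl0 hlt] at this
  -- The opposite corner `(x.1, y.2)` leaves a function of `x.1` instead.
  have hGb : ∀ᵐ x ∂(ν.prod ν), l * ‖k x‖ₑ ≤ l * F₂ x.1 + D₁ := by
    filter_upwards [hmem] with x hx
    have h := enorm_le_of_integral_eq_zero hint h0 x
    have h' : ∫⁻ y, ‖k x - k y‖ₑ ∂(ν.prod ν) ≤ ∫⁻ y, (F₂ x.1 + F₁ y.2) ∂(ν.prod ν) := by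
      refine lintegral_mono_ae ?_
      filter_upwards [hmem] with y hy
      have : k x - k y = (k (x.1, x.2) - k (x.1, y.2)) + (k (x.1, y.2) - k (y.1, y.2)) := by simp
      rw [this]
      exact (enorm_add_le _ _).trans (add_le_add (e₂ _ _ hx.2 _ hy.2) (e₁ _ hx.1 _ hy.1 _))
    have h'' : ∫⁻ y, (F₂ x.1 + F₁ y.2) ∂(ν.prod ν) = l * (l * F₂ x.1 + D₁) := by
      rw [lintegral_add_left measurable_const, lintegral_const, huniv,
        lintegral_prod (fun y : ℝ × ℝ => F₁ y.2) (by fun_prop)]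
      simp only [lintegral_const, hl, hI₁]
      ring
    have := (h.trans h').trans_eq h''
    rwa [huniv, mul_assoc, ENNReal.mul_le_mul_iff_right hl0 hlt] at this
  have key := lintegral_sq_le_of_le_of_le (G := fun x => l * ‖k x‖ₑ)
    (a := fun t => l * F₁ t + D₂) (b := fun s => l * F₂ s + D₁)
    (by fun_prop) (by fun_prop) hGa hGb
  rw [lintegral_add_right _ measurable_const, lintegral_add_right _ measurable_const,
    lintegral_const_mul _ hm₁, lintegral_const_mul _ hm₂, hI₁, hI₂, lintegral_const,
    lintegral_const, hl] at key
  simp only [mul_pow] at key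
  rw [lintegral_const_mul _ (hk.enorm.measurable.pow_const 2)] at key
  have e : (l * D₂ + D₁ * l) * (l * D₁ + D₂ * l) = l ^ 2 * (D₁ + D₂) ^ 2 := by ring
  rwa [e, ENNReal.mul_le_mul_iff_right (pow_ne_zero 2 hl0) (ENNReal.pow_ne_top hlt)] at key

end Square

/-! ### Transfer to `Ω` and Ladyzhenskaya's inequality -/

section Box

/-- Cartesian coordinates on the plane. -/
def planeOfProd : ℝ × ℝ → Plane := fun x => WithLp.toLp 2 ![x.1, x.2]

lemma continuous_planeOfProd : Continuous planeOfProd := by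
  unfold planeOfProd
  refine (PiLp.continuous_toLp 2 _).comp (continuous_pi fun i => ?_)
  fin_cases i
  · exact continuous_fst
  · exact continuous_snd

lemma measurePreserving_planeOfProd (L : ℝ) :
    MeasurePreserving planeOfProd
      ((volume.restrict (Set.Icc 0 L)).prod (volume.restrict (Set.Icc 0 L))) (boxMeasure L) := by
  have h : MeasurePreserving planeOfProd (volume : Measure (ℝ × ℝ)) (volume : Measure Plane) :=
    (PiLp.volume_preserving_toLp (Fin 2)).comp (volume_preserving_finTwoArrow ℝ).symm
  have h2 := h.restrict_preimage (isCompact_box L).measurableSet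
  have h3 : planeOfProd ⁻¹' box L = Set.Icc 0 L ×ˢ Set.Icc 0 L := by
    ext x
    simp only [planeOfProd, box, Set.mem_preimage, Set.mem_ofPred_eq, Fin.forall_fin_two,
      Set.mem_prod]
    rfl
  rw [Measure.prod_restrict]
  rwa [h3] at h2

lemma planeOfProd_fst_hasDerivAt (s t : ℝ) :
    HasDerivAt (fun s => planeOfProd (s, t)) (EuclideanSpace.single 0 1) s := by
  have : (fun s => planeOfProd (s, t)) = fun s : ℝ =>
      s • (EuclideanSpace.single 0 1 : Plane) + t • (EuclideanSpace.single 1 1 : Plane) := by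
    funext s
    ext i
    fin_cases i <;> simp [planeOfProd]
  rw [this]
  simpa using ((hasDerivAt_id s).smul_const (EuclideanSpace.single 0 1 : Plane)).add_const
    (t • (EuclideanSpace.single 1 1 : Plane))

lemma planeOfProd_snd_hasDerivAt (s t : ℝ) :
    HasDerivAt (fun t => planeOfProd (s, t)) (EuclideanSpace.single 1 1) t := by
  have : (fun t => planeOfProd (s, t)) = fun t : ℝ =>
      s • (EuclideanSpace.single 0 1 : Plane) + t • (EuclideanSpace.single 1 1 : Plane) := by
    funext t
    ext i
    fin_cases i <;> simp [planeOfProd]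
  rw [this]
  simpa using ((hasDerivAt_id t).smul_const (EuclideanSpace.single 1 1 : Plane)).const_add
    (s • (EuclideanSpace.single 0 1 : Plane))

variable {E : Type*} [NormedAddCommGroup E] [NormedSpace ℝ E] [CompleteSpace E]

lemma eLpNorm_two_eq {X F : Type*} [MeasurableSpace X] [NormedAddCommGroup F] (f : X → F)
    (μ : Measure X) : eLpNorm f 2 μ ^ 2 = ∫⁻ x, ‖f x‖ₑ ^ 2 ∂μ := by
  rw [eLpNorm_eq_lintegral_rpow_enorm_toReal (by norm_num) (by norm_num), ← ENNReal.rpow_natCast,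
    ← ENNReal.rpow_mul]
  simp

/-- The values lie in a general `E` because this serves both a vector field and the scalar `|p|² -
c`. -/
theorem eLpNorm_two_le_of_integral_eq_zero {L : ℝ} (hL : 0 < L) {k : Plane → E}
    (hk : ContDiff ℝ 1 k) (h0 : ∫ x, k x ∂(boxMeasure L) = 0) :
    eLpNorm k 2 (boxMeasure L) ≤
      ∑ j, eLpNorm (fun x => fderiv ℝ k x (EuclideanSpace.single j 1)) 1 (boxMeasure L) := by
  have hd : ∀ j : Fin 2, Continuous fun x => fderiv ℝ k x (EuclideanSpace.single j 1) := fun j =>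
    (hk.continuous_fderiv (by norm_num)).clm_apply continuous_const
  have hdiff : ∀ x, HasFDerivAt k (fderiv ℝ k x) x := fun x =>
    (hk.differentiable (by norm_num) x).hasFDerivAt
  have hP := measurePreserving_planeOfProd L
  have key := lintegral_sq_le_of_integral_eq_zero hL
    (k := fun x => k (planeOfProd x))
    (d₁ := fun x => fderiv ℝ k (planeOfProd x) (EuclideanSpace.single 0 1))
    (d₂ := fun x => fderiv ℝ k (planeOfProd x) (EuclideanSpace.single 1 1))
    (hk.continuous.comp continuous_planeOfProd) ((hd 0).comp continuous_planeOfProd)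
    ((hd 1).comp continuous_planeOfProd)
    (fun s t => (hdiff _).comp_hasDerivAt s (planeOfProd_fst_hasDerivAt s t))
    (fun s t => (hdiff _).comp_hasDerivAt t (planeOfProd_snd_hasDerivAt s t))
    (by
      rw [← h0, ← hP.map_eq, integral_map hP.measurable.aemeasurable
        hk.continuous.aestronglyMeasurable])
  rw [hP.lintegral_comp (f := fun x => ‖k x‖ₑ ^ 2) (hk.continuous.enorm.measurable.pow_const 2),
    hP.lintegral_comp (hd 0).enorm.measurable, hP.lintegral_comp (hd 1).enorm.measurable,
    ← eLpNorm_two_eq] at key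
  rw [Fin.sum_univ_two, eLpNorm_one_eq_lintegral_enorm, eLpNorm_one_eq_lintegral_enorm]
  exact (ENNReal.pow_le_pow_left_iff two_ne_zero).1 key

lemma eLpNorm_sq_norm {X F : Type*} [MeasurableSpace X] [NormedAddCommGroup F] (f : X → F)
    (μ : Measure X) (p : ENNReal) :
    eLpNorm (fun x => ‖f x‖ ^ 2) p μ = eLpNorm f (p * 2) μ ^ 2 := by
  have := eLpNorm_norm_rpow (μ := μ) (p := p) f (q := 2) (by norm_num)
  simpa using this

/-- Ladyzhenskaya's inequality for periodic fields of zero average, with the Poincaré inequality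
built in. -/
theorem exists_eLpNorm_four_le {L : ℝ} (hL : 0 < L) :
    ∃ C : ENNReal, C ≠ ⊤ ∧ ∀ p : Plane → Plane, ContDiff ℝ 1 p →
      ∫ x, p x ∂(boxMeasure L) = 0 →
      eLpNorm p 4 (boxMeasure L) ≤ C * ∑ j, eLpNorm (partialDeriv j p) 2 (boxMeasure L) := by
  set μ := boxMeasure L
  set M : ENNReal := ‖(μ.real Set.univ)⁻¹‖ₑ * μ Set.univ ^ (1 / 2 : ℝ)
  set m : ENNReal := μ Set.univ ^ (1 / 2 : ℝ)
  have hm : m ≠ ⊤ := ENNReal.rpow_ne_top_of_nonneg (by norm_num) (measure_ne_top _ _)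
  have hM : M ≠ ⊤ := ENNReal.mul_ne_top enorm_ne_top hm
  -- The estimates below give `‖p‖₄² ≤ (M m² + 2m) G²`. Adding `1` makes the constant `C` at least
  -- `1`, so `C ≤ C²` and no square root is needed.
  refine ⟨M * m ^ 2 + 2 * m + 1, by finiteness, fun p hp h0 => ?_⟩
  have hd : ∀ j : Fin 2, Continuous (partialDeriv j p) := fun j =>
    (hp.continuous_fderiv (by norm_num)).clm_apply continuous_const
  set G := ∑ j, eLpNorm (partialDeriv j p) 2 μ with hG
  set N := eLpNorm p 2 μ with hN
  -- Poincaré: the zero-average estimate, then `L² ⊂ L¹` on a space of finite measure.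
  have hNG : N ≤ m * G := by
    refine (eLpNorm_two_le_of_integral_eq_zero hL hp h0).trans ?_
    rw [hG, Finset.mul_sum]
    refine Finset.sum_le_sum fun j _ => ?_
    refine (eLpNorm_le_eLpNorm_mul_rpow_measure_univ (q := 2) (by norm_num)
      (hd j).aestronglyMeasurable).trans_eq ?_
    rw [mul_comm]
    congr 2
    norm_num
  -- Subtracting the average makes the zero-average estimate applicable to `|p|²`, whose `L²` norm
  -- is `‖p‖₄²`.
  set c : ℝ := ⨍ x, ‖p x‖ ^ 2 ∂μ
  have hsq : ContDiff ℝ 1 fun x => ‖p x‖ ^ 2 := hp.norm_sq ℝ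
  have hk : ContDiff ℝ 1 fun x => ‖p x‖ ^ 2 - c := hsq.sub contDiff_const
  have hder : ∀ j : Fin 2, ∀ x, fderiv ℝ (fun x => ‖p x‖ ^ 2 - c) x (EuclideanSpace.single j 1) =
      2 * inner ℝ (p x) (partialDeriv j p x) := fun j x => by
    have h := ((hp.differentiable (by norm_num) x).hasFDerivAt.norm_sq).sub_const c
    rw [h.fderiv]
    simp [partialDeriv]
  have h1 := eLpNorm_two_le_of_integral_eq_zero hL hk (integral_sub_average _ _)
  have h2 : ∑ j, eLpNorm (fun x => fderiv ℝ (fun x => ‖p x‖ ^ 2 - c) x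
      (EuclideanSpace.single j 1)) 1 μ ≤ 2 * N * G := by
    rw [hG, Finset.mul_sum]
    refine Finset.sum_le_sum fun j _ => ?_
    simp only [hder]
    refine (eLpNorm_le_eLpNorm_mul_eLpNorm_of_nnnorm (p := 2) (q := 2) (r := 1)
      hp.continuous.aestronglyMeasurable (hd j).aestronglyMeasurable
      (fun a b => 2 * inner ℝ a b) 2 (ae_of_all _ fun x => ?_)).trans_eq ?_
    · rw [← NNReal.coe_le_coe]
      push_cast
      rw [norm_mul, mul_assoc]
      simpa using abs_real_inner_le_norm (p x) (partialDeriv j p x)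
    · simp [hN]
  have h3 : eLpNorm (fun _ : Plane => c) 2 μ ≤ M * N ^ 2 := by
    have hc : ‖c‖ₑ ≤ ‖(μ.real Set.univ)⁻¹‖ₑ * N ^ 2 := by
      have : c = (μ.real Set.univ)⁻¹ • ∫ x, ‖p x‖ ^ 2 ∂μ := average_eq _ _
      rw [this, enorm_smul]
      gcongr
      refine (enorm_integral_le_lintegral_enorm _).trans_eq ?_
      rw [← eLpNorm_one_eq_lintegral_enorm, eLpNorm_sq_norm, one_mul]
    rw [eLpNorm_const' c (by norm_num) (by norm_num), ENNReal.toReal_ofNat]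
    calc ‖c‖ₑ * m ≤ ‖(μ.real Set.univ)⁻¹‖ₑ * N ^ 2 * m := by gcongr
      _ = M * N ^ 2 := by ring
  have h4 : eLpNorm p 4 μ ^ 2 ≤ 2 * N * G + M * N ^ 2 := by
    have : (4 : ENNReal) = 2 * 2 := by norm_num
    rw [this, ← eLpNorm_sq_norm]
    have e : (fun x => ‖p x‖ ^ 2) = (fun x => ‖p x‖ ^ 2 - c) + fun _ => c := by
      funext x; simp
    rw [e]
    exact (eLpNorm_add_le hk.continuous.aestronglyMeasurable aestronglyMeasurable_const
      (by norm_num)).trans (add_le_add (h1.trans h2) h3)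
  refine (ENNReal.pow_le_pow_left_iff two_ne_zero).1 (h4.trans ?_)
  set C := M * m ^ 2 + 2 * m + 1
  calc 2 * N * G + M * N ^ 2 ≤ 2 * (m * G) * G + M * (m * G) ^ 2 := by gcongr
    _ = (M * m ^ 2 + 2 * m) * G ^ 2 := by ring
    _ ≤ C * 1 * G ^ 2 := by
      rw [mul_one]
      gcongr
      exact le_self_add
    _ ≤ C * C * G ^ 2 := by
      gcongr
      exact le_add_self
    _ = (C * G) ^ 2 := by ring

end Box

/-! ### From trigonometric polynomials to `V ⊂ L⁴` -/

variable {L : ℝ}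

lemma partialDeriv_eLpNorm_le (p : solenoidal L) (j : Fin 2) :
    eLpNorm (partialDeriv j p.1) 2 (boxMeasure L) ≤ ‖(toGraph L p).2‖ₑ := by
  have h : ‖derivToL2 L j p‖ ≤ ‖(toGraph L p).2‖ := PiLp.norm_apply_le (toGraph L p).2 j
  have h2 : ‖derivToL2 L j p‖ₑ = eLpNorm (partialDeriv j p.1) 2 (boxMeasure L) :=
    Lp.enorm_toLp (memLp_of_continuous L (continuous_partialDeriv p.2.1 j))
  rw [← h2]
  exact enorm_le_iff_norm_le.2 h

/-- The embedding `V ⊂ L⁴(Ω)²`. -/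
theorem exists_eLpNorm_fn_le (hL : 0 < L) :
    ∃ C : ENNReal, C ≠ ⊤ ∧ ∀ u : SpaceV L, eLpNorm u.fn 4 (boxMeasure L) ≤ C * ‖u‖ₑ := by
  obtain ⟨C, hC, h⟩ := exists_eLpNorm_four_le hL
  refine ⟨C * 2, ENNReal.mul_ne_top hC (by norm_num), fun u => ?_⟩
  have hu : (u : closureH1 L).1 ∈ closure (LinearMap.range (toGraph L) : Set (L2 L × GradL2 L)) :=
    (u : closureH1 L).2
  obtain ⟨y, hy, hlim⟩ := mem_closure_iff_seq_limit.1 hu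
  choose p hp using hy
  have h1 : Tendsto (fun n => toL2 L (p n)) atTop (𝓝 u.fn) := by
    have := (continuous_fst.tendsto _).comp hlim
    simp only [Function.comp_def, ← hp] at this
    exact this
  have h2 : Tendsto (fun n => ‖(toGraph L (p n)).2‖ₑ) atTop (𝓝 ‖u‖ₑ) := by
    have := ((continuous_enorm.comp continuous_snd).tendsto _).comp hlim
    simp only [Function.comp_def, ← hp] at this
    exact this
  -- A subsequence of the `L²`-convergent approximants converges a.e., and Fatou's lemma carries the
  -- `L⁴` bound to the limit.
  have h3 : TendstoInMeasure (boxMeasure L) (fun n => (p n).1) atTop u.fn := by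
    refine (tendstoInMeasure_of_tendsto_Lp h1).congr_left fun n => ?_
    exact (memLp_of_continuous L (contDiff_of_mem_trigPoly (p n).2.1).continuous).coeFn_toLp
  obtain ⟨ns, hns, hae⟩ := h3.exists_seq_tendsto_ae
  refine (Lp.eLpNorm_lim_le_liminf_eLpNorm
    (fun n => (contDiff_of_mem_trigPoly (p (ns n)).2.1).continuous.aestronglyMeasurable)
    _ hae).trans ?_
  have h4 : Tendsto (fun n => C * 2 * ‖(toGraph L (p (ns n))).2‖ₑ) atTop (𝓝 (C * 2 * ‖u‖ₑ)) :=
    ENNReal.Tendsto.const_mul (h2.comp hns.tendsto_atTop)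
      (Or.inr (ENNReal.mul_ne_top hC (by norm_num)))
  rw [← h4.liminf_eq]
  refine liminf_le_liminf (Eventually.of_forall fun n => ?_)
  refine (h _ (contDiff_of_mem_trigPoly (p (ns n)).2.1) (p (ns n)).2.2.2).trans ?_
  rw [mul_assoc]
  gcongr
  rw [Fin.sum_univ_two, two_mul]
  exact add_le_add (partialDeriv_eLpNorm_le _ _) (partialDeriv_eLpNorm_le _ _)

lemma memLp_fn (hL : 0 < L) (u : SpaceV L) : MemLp u.fn 4 (boxMeasure L) := by
  obtain ⟨C, hC, h⟩ := exists_eLpNorm_fn_le hL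
  exact ⟨(Lp.memLp u.fn).1, (h u).trans_lt (ENNReal.mul_lt_top hC.lt_top enorm_lt_top)⟩

/-! ### Hölder's inequality and the trilinear form -/

section Holder

variable {X F : Type*} [MeasurableSpace X] {μ : Measure X} [NormedAddCommGroup F]
  [InnerProductSpace ℝ F]

instance holderTriple_four_four_two : ENNReal.HolderTriple 4 4 2 := ⟨by
  rw [show (4 : ENNReal) = 2 * 2 by norm_num,
    ENNReal.mul_inv (Or.inl (by norm_num)) (Or.inl (by norm_num)), ← mul_add,
    ENNReal.inv_two_add_inv_two, mul_one]⟩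

/-- Hölder with `1/4 + 1/2 + 1/4 = 1`: moving the scalar `f` onto `b` reduces it to two bilinear
steps. -/
lemma eLpNorm_inner_smul_le {f : X → ℝ} {a b : X → F} (hf : MemLp f 4 μ) (ha : MemLp a 2 μ)
    (hb : MemLp b 4 μ) :
    eLpNorm (fun x => inner ℝ (f x • a x) (b x)) 1 μ ≤
      eLpNorm f 4 μ * eLpNorm a 2 μ * eLpNorm b 4 μ := by
  have h1 : eLpNorm (f • b) 2 μ ≤ eLpNorm f 4 μ * eLpNorm b 4 μ :=
    eLpNorm_smul_le_mul_eLpNorm hb.1 hf.1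
  have h2 := eLpNorm_le_eLpNorm_mul_eLpNorm_of_nnnorm (p := 2) (q := 2) (r := 1) ha.1
      (hf.1.smul hb.1) (fun a b => inner ℝ a b) 1 (ae_of_all _ fun x => by
        rw [one_mul]; exact nnnorm_inner_le_nnnorm _ _)
  calc _ = eLpNorm (fun x => inner ℝ (a x) ((f • b) x)) 1 μ := by
        simp only [real_inner_smul_left, Pi.smul_apply', real_inner_smul_right]
    _ ≤ eLpNorm a 2 μ * eLpNorm (f • b) 2 μ := by simpa using h2
    _ ≤ eLpNorm a 2 μ * (eLpNorm f 4 μ * eLpNorm b 4 μ) := by gcongr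
    _ = _ := by ring

lemma integrable_inner_smul {f : X → ℝ} {a b : X → F} (hf : MemLp f 4 μ) (ha : MemLp a 2 μ)
    (hb : MemLp b 4 μ) : Integrable (fun x => inner ℝ (f x • a x) (b x)) μ := by
  refine memLp_one_iff_integrable.1 ⟨(hf.1.smul ha.1).inner hb.1, ?_⟩
  refine (eLpNorm_inner_smul_le hf ha hb).trans_lt ?_
  exact ENNReal.mul_lt_top (ENNReal.mul_lt_top hf.2 ha.2) hb.2

end Holder

lemma memLp_fn_apply (hL : 0 < L) (u : SpaceV L) (j : Fin 2) :
    MemLp (fun x => u.fn x j) 4 (boxMeasure L) :=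
  (memLp_fn hL u).continuousLinearMap_comp (EuclideanSpace.proj (𝕜 := ℝ) j)

lemma integrable_opB (hL : 0 < L) (u v w : SpaceV L) (j : Fin 2) :
    Integrable (fun x => inner ℝ (u.fn x j • v.grad j x) (w.fn x)) (boxMeasure L) :=
  integrable_inner_smul (memLp_fn_apply hL u j) (Lp.memLp _) (memLp_fn hL w)

lemma opB_eq_sum (hL : 0 < L) (u v w : SpaceV L) : opB u v w =
    ∑ j, ∫ x, inner ℝ (u.fn x j • v.grad j x) (w.fn x) ∂(boxMeasure L) := by
  unfold opB
  simp only [sum_inner]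
  exact integral_finsetSum _ fun j _ => integrable_opB hL u v w j

/-- Boundedness of the trilinear form. -/
theorem exists_norm_opB_le (hL : 0 < L) :
    ∃ C : ℝ, ∀ u v w : SpaceV L, ‖opB u v w‖ ≤ C * ‖u‖ * ‖v‖ * ‖w‖ := by
  obtain ⟨C, hC, h⟩ := exists_eLpNorm_fn_le hL
  refine ⟨2 * C.toReal ^ 2, fun u v w => ?_⟩
  have hj : ∀ j : Fin 2, ‖∫ x, inner ℝ (u.fn x j • v.grad j x) (w.fn x) ∂(boxMeasure L)‖ₑ ≤
      C ^ 2 * ‖u‖ₑ * ‖v‖ₑ * ‖w‖ₑ := fun j => by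
    have h1 : eLpNorm (fun x => u.fn x j) 4 (boxMeasure L) ≤ C * ‖u‖ₑ :=
      (eLpNorm_mono fun x => PiLp.norm_apply_le (u.fn x) j).trans (h u)
    have h2 : eLpNorm (v.grad j) 2 (boxMeasure L) ≤ ‖v‖ₑ := by
      rw [← Lp.enorm_def]
      exact enorm_le_iff_norm_le.2 (PiLp.norm_apply_le v.grad j)
    calc _ ≤ eLpNorm (fun x => inner ℝ (u.fn x j • v.grad j x) (w.fn x)) 1 (boxMeasure L) := by
          rw [eLpNorm_one_eq_lintegral_enorm]
          exact enorm_integral_le_lintegral_enorm _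
      _ ≤ _ := eLpNorm_inner_smul_le (memLp_fn_apply hL u j) (Lp.memLp _) (memLp_fn hL w)
      _ ≤ (C * ‖u‖ₑ) * ‖v‖ₑ * (C * ‖w‖ₑ) := by gcongr; exact h w
      _ = _ := by ring
  have hj' : ∀ j : Fin 2, ‖∫ x, inner ℝ (u.fn x j • v.grad j x) (w.fn x) ∂(boxMeasure L)‖ ≤
      C.toReal ^ 2 * ‖u‖ * ‖v‖ * ‖w‖ := fun j => by
    have := ENNReal.toReal_mono (by finiteness) (hj j)
    simpa using this
  rw [opB_eq_sum hL, Fin.sum_univ_two]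
  refine (norm_add_le _ _).trans ((add_le_add (hj' 0) (hj' 1)).trans_eq ?_)
  ring

/-! ### Bilinearity and continuity of the operators -/

lemma fn_add_ae (u v : SpaceV L) :
    (u + v).fn =ᵐ[boxMeasure L] fun x => u.fn x + v.fn x := by
  rw [map_add]
  exact Lp.coeFn_add _ _

lemma fn_smul_ae (c : ℝ) (u : SpaceV L) :
    (c • u).fn =ᵐ[boxMeasure L] fun x => c • u.fn x := by
  rw [map_smul]
  exact Lp.coeFn_smul _ _

lemma grad_add_ae (u v : SpaceV L) (j : Fin 2) :
    (u + v).grad j =ᵐ[boxMeasure L] fun x => u.grad j x + v.grad j x := by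
  rw [map_add]
  exact Lp.coeFn_add _ _

lemma grad_smul_ae (c : ℝ) (u : SpaceV L) (j : Fin 2) :
    (c • u).grad j =ᵐ[boxMeasure L] fun x => c • u.grad j x := by
  rw [map_smul]
  exact Lp.coeFn_smul _ _

/-- `(u, v) ↦ ⟨B(u, v), w⟩` as a bounded bilinear form on `V`. -/
def formB (hL : 0 < L) (w : SpaceV L) : SpaceV L →L[ℝ] SpaceV L →L[ℝ] ℝ :=
  LinearMap.mkContinuous₂
    (LinearMap.mk₂ ℝ (fun u v => opB u v w)
      (fun u u' v => by
        simp only [opB_eq_sum hL, ← Finset.sum_add_distrib]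
        refine Finset.sum_congr rfl fun j _ => ?_
        rw [← integral_add (integrable_opB hL u v w j) (integrable_opB hL u' v w j)]
        refine integral_congr_ae ?_
        filter_upwards [fn_add_ae u u'] with x hx
        rw [hx, PiLp.add_apply, add_smul, inner_add_left])
      (fun c u v => by
        simp only [opB_eq_sum hL, Finset.smul_sum]
        refine Finset.sum_congr rfl fun j _ => ?_
        rw [← integral_smul]
        refine integral_congr_ae ?_
        filter_upwards [fn_smul_ae c u] with x hx
        rw [hx, PiLp.smul_apply, smul_assoc, real_inner_smul_left, smul_eq_mul])
      (fun u v v' => by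
        simp only [opB_eq_sum hL, ← Finset.sum_add_distrib]
        refine Finset.sum_congr rfl fun j _ => ?_
        rw [← integral_add (integrable_opB hL u v w j) (integrable_opB hL u v' w j)]
        refine integral_congr_ae ?_
        filter_upwards [grad_add_ae v v' j] with x hx
        rw [hx, smul_add, inner_add_left])
      (fun c u v => by
        simp only [opB_eq_sum hL, Finset.smul_sum]
        refine Finset.sum_congr rfl fun j _ => ?_
        rw [← integral_smul]
        refine integral_congr_ae ?_
        filter_upwards [grad_smul_ae c v j] with x hx
        rw [hx, smul_comm, real_inner_smul_left, smul_eq_mul]))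
    ((exists_norm_opB_le hL).choose * ‖w‖)
    (fun u v => ((exists_norm_opB_le hL).choose_spec u v w).trans_eq (by ring))

lemma formB_apply (hL : 0 < L) (u v w : SpaceV L) : formB hL w u v = opB u v w := rfl

lemma opA_eq_inner (u w : SpaceV L) : opA u w = inner ℝ u.grad w.grad := by
  unfold opA
  rw [integral_finsetSum _ fun j _ => L2.integrable_inner _ _, PiLp.inner_apply]
  simp only [L2.inner_def]

lemma tendsto_opA {z : ℕ → SpaceV L} {v : SpaceV L}
    (h : Tendsto (fun n => ‖z n - v‖) atTop (𝓝 0)) (w : SpaceV L) :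
    Tendsto (fun n => opA (z n) w) atTop (𝓝 (opA v w)) := by
  simp only [opA_eq_inner]
  have hg : Tendsto (fun n => (z n).grad) atTop (𝓝 v.grad) := by
    rw [tendsto_iff_norm_sub_tendsto_zero]
    simp only [← map_sub]
    exact h
  exact hg.inner tendsto_const_nhds

lemma tendsto_opB (hL : 0 < L) {y z : ℕ → SpaceV L} {u v : SpaceV L}
    (hy : Tendsto y atTop (𝓝 u)) (hz : Tendsto z atTop (𝓝 v)) (w : SpaceV L) :
    Tendsto (fun n => opB (y n) (z n) w) atTop (𝓝 (opB u v w)) := by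
  have h : Continuous fun p : SpaceV L × SpaceV L => formB hL w p.1 p.2 :=
    (formB hL w).continuous₂
  have h' := (h.tendsto (u, v)).comp (hy.prodMk_nhds hz)
  simpa only [Function.comp_def, formB_apply] using h'

end SteadyNSE

end

/-! ### Passage to the limit in the steady equation -/

open SteadyNSE in
theorem theorem4p3 (L : ℝ) (hL : 0 < L)
    (g : SteadyNSE.spaceH L) (hg : g ≠ 0)
    (α : ℕ → ℝ) (hα : ∀ n, 0 < α n) (hα_lim : Filter.Tendsto α Filter.atTop Filter.atTop)
    (z : ℕ → SteadyNSE.SpaceV L)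
    (hz : ∀ n, SteadyNSE.opA (z n) + α n • SteadyNSE.opB (z n) (z n)
      = SteadyNSE.functionalOfH g)
    (v : SteadyNSE.SpaceV L) (K : ℕ∞) (Γ : ℕ → ℕ → ℝ) (w : ℕ → SteadyNSE.SpaceV L)
    (hexp : SteadyNSE.IsUnitaryExpansion z v K Γ w ∨
      SteadyNSE.IsDegenerateExpansion z v K Γ w) :
    SteadyNSE.opB v v = 0 ∧
    (K = 0 → SteadyNSE.opA v = SteadyNSE.functionalOfH g) ∧
    (K ≠ 0 →
      (SteadyNSE.SeqSuccsim (fun _ => 1) (fun n => α n * Γ 1 n) →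
        ∃ μ : ℝ, 0 ≤ μ ∧ Filter.Tendsto (fun n => α n * Γ 1 n) Filter.atTop (nhds μ) ∧
          SteadyNSE.opA v + μ • SteadyNSE.opBs v (w 1) = SteadyNSE.functionalOfH g) ∧
      (SteadyNSE.SeqSucc (fun n => α n * Γ 1 n) (fun _ => 1) →
        SteadyNSE.opBs v (w 1) = 0)) := by
  have hrel : IsRelaxedExpansion z v K Γ w := hexp.elim (fun h => h.1) fun h => h.2.1
  obtain ⟨r, hr, hzr, -⟩ := hrel.remainder
  have hmem : K ≠ 0 → 1 ∈ indexSet K := fun hK =>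
    ⟨le_rfl, by simpa using Order.one_le_iff_ne_zero.2 hK⟩
  have hz1 : K ≠ 0 → ∀ n, z n = v + Γ 1 n • r 1 n := fun hK n => by
    simpa using hzr 1 (hmem hK) n
  have hr1 : K ≠ 0 → Tendsto (r 1) atTop (𝓝 (w 1)) := fun hK =>
    tendsto_iff_norm_sub_tendsto_zero.2 (hr 1 (hmem hK))
  have hzv : Tendsto z atTop (𝓝 v) := by
    rcases eq_or_ne K 0 with hK | hK
    · rw [show z = fun _ => v from funext (hrel.trivial hK)]
      exact tendsto_const_nhds
    · rw [show z = fun n => v + Γ 1 n • r 1 n from funext (hz1 hK)]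
      simpa using tendsto_const_nhds.add ((hrel.first (hmem hK)).smul (hr1 hK))
  have hA : ∀ y, Tendsto (fun n => opA (z n) y) atTop (𝓝 (opA v y)) :=
    tendsto_opA (tendsto_iff_norm_sub_tendsto_zero.1 hzv)
  have heq : ∀ n y, opA (z n) y + α n * opB (z n) (z n) y = functionalOfH g y := fun n y =>
    congrFun (hz n) y
  have hBv : opB v v = 0 := by
    funext y
    have h1 : Tendsto (fun n => opB (z n) (z n) y) atTop (𝓝 (opB v v y)) :=
      tendsto_opB hL hzv hzv y
    have h2 : Tendsto (fun n => (α n)⁻¹ * (functionalOfH g y - opA (z n) y)) atTop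
        (𝓝 (0 * (functionalOfH g y - opA v y))) :=
      hα_lim.inv_tendsto_atTop.mul (tendsto_const_nhds.sub (hA y))
    rw [zero_mul] at h2
    refine tendsto_nhds_unique h1 (h2.congr fun n => ?_)
    rw [← heq n y]
    have := (hα n).ne'
    field_simp
    ring
  refine ⟨hBv, fun hK => ?_, fun hK => ?_⟩
  · have h := hz 0
    rw [hrel.trivial hK 0, hBv, smul_zero, add_zero] at h
    exact h
  have hΓ : ∀ n, 0 < Γ 1 n := hrel.pos 1 (hmem hK)
  -- This is `B(zₙ, zₙ)/Γ₁ₙ`; its quadratic term disappears because `Γ₁ₙ → 0`.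
  have hQ : ∀ y, Tendsto (fun n => opB v (r 1 n) y + opB (r 1 n) v y +
      Γ 1 n * opB (r 1 n) (r 1 n) y) atTop (𝓝 (opBs v (w 1) y)) := fun y => by
    have h1 := tendsto_opB hL (tendsto_const_nhds (x := v)) (hr1 hK) y
    have h2 := tendsto_opB hL (hr1 hK) (tendsto_const_nhds (x := v)) y
    have h3 := tendsto_opB hL (hr1 hK) (hr1 hK) y
    simpa [opBs] using (h1.add h2).add ((hrel.first (hmem hK)).mul h3)
  have heq' : ∀ n y, opA (z n) y + α n * Γ 1 n * (opB v (r 1 n) y + opB (r 1 n) v y +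
      Γ 1 n * opB (r 1 n) (r 1 n) y) = functionalOfH g y := fun n y => by
    -- `B(v, v) = 0` removes the term of order zero, which lets `Γ₁ₙ` factor out.
    have hB : opB (z n) (z n) y = Γ 1 n * (opB v (r 1 n) y + opB (r 1 n) v y +
        Γ 1 n * opB (r 1 n) (r 1 n) y) := by
      have hv : formB hL y v v = 0 := congrFun hBv y
      rw [hz1 hK n, ← formB_apply hL]
      simp only [map_add, map_smul, add_apply, smul_apply,
        smul_eq_mul, hv]
      simp only [formB_apply]
      ring
    rw [← heq n y, hB]
    ring
  refine ⟨fun hs => ?_, fun hs => ?_⟩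
  · obtain ⟨μ, hμ, hlim⟩ : ∃ μ : ℝ, 0 ≤ μ ∧ Tendsto (fun n => α n * Γ 1 n) atTop (𝓝 μ) := by
      rcases hs with hs | ⟨l, hl, hs⟩
      · exact ⟨0, le_rfl, hs.inv_tendsto_atTop.congr fun n => by simp⟩
      · exact ⟨l⁻¹, (inv_pos.2 hl).le, by simpa using hs.inv₀ hl.ne'⟩
    refine ⟨μ, hμ, hlim, funext fun y => ?_⟩
    refine tendsto_nhds_unique ((hA y).add (hlim.mul (hQ y))) ?_
    exact tendsto_const_nhds.congr fun n => (heq' n y).symm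
  · funext y
    have hs' : Tendsto (fun n => α n * Γ 1 n) atTop atTop := by simpa [SeqSucc] using hs
    -- The division argument for `B(v, v) = 0` again, now with the diverging factor `αₙ Γ₁ₙ`.
    have h2 : Tendsto (fun n => (α n * Γ 1 n)⁻¹ * (functionalOfH g y - opA (z n) y)) atTop
        (𝓝 (0 * (functionalOfH g y - opA v y))) :=
      hs'.inv_tendsto_atTop.mul (tendsto_const_nhds.sub (hA y))
    rw [zero_mul] at h2
    refine tendsto_nhds_unique (hQ y) (h2.congr fun n => ?_)
    rw [← heq' n y, add_sub_cancel_left, inv_mul_cancel_left₀ (mul_pos (hα n) (hΓ n)).ne']
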